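/- **Setting.** An instance of online bipartite matching is a finite bipartite graph $G=(S\cup R,E)$ whose servers $S$ are known in advance and whose requests $R$ arrive one by one in a fixed order; the neighbors of a request are revealed when it arrives. The algorithm Ranking first draws for every server $s\in S$ independently a rank $y_s$ uniformly from $[0,1]$; then each arriving request is matched to its unmatched neighbor of smallest rank (ties, which have probability $0$, are broken arbitrarily), and stays unmatched if it has no unmatched neighbor. Let $\mathsf{ALG}$ be the size of the resulting matching and $\mathsf{OPT}$ the size of a maximum matching of $G$. The competitive ratio of Ranking on $d$-regular graphs is the infimum of $\mathbb{E}[\mathsf{ALG}]/\mathsf{OPT}$ over all instances with $\mathsf{OPT}>0$ in which every server and every request has degree exactly $d$. **Theorem.** For every integer $d\ge 2$, the competitive ratio of Ranking on $d$-regular graphs is at most $$\gamma(d)=1-\frac{d-1}{2d-1}\left(1-\frac1d\right)^d .$$ This is witnessed by the following instance with servers $s_1,\dots,s_{2d-1}$ and requests $r_1,\dots,r_{2d-1}$ arriving in the order $r_1,r_2,\dots,r_{2d-1}$: the edges are $s_ir_i$ for $1\le i\le d$, all $s_jr_i$ with $1\le i\le d<j\le 2d-1$, and all $s_ir_j$ with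 $1\le i\le d<j\le 2d-1$. This instance is $d$-regular, has $2d-1$ servers and $\mathsf{OPT}=2d-1$, and satisfies $\mathbb{E}[\mathsf{ALG}]/\mathsf{OPT}\le\gamma(d)$. -/

import Mathlib

open MeasureTheory

/-- An instance of online bipartite matching: a bipartite graph between `numServers` offline servers
and `numRequests` online requests, where the requests arrive in the order `0, 1, 2, …`, and
`Edge s r` says that server `s` and request `r` are neighbors. -/
structure OnlineInstance where
  numServers : ℕ
  numRequests : ℕ
  Edge : Fin numServers → Fin numRequests → Prop

namespace OnlineInstance

variable (I : OnlineInstance)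

/-- The servers of the instance. -/
abbrev Server : Type := Fin I.numServers

/-- The requests of the instance, listed in their order of arrival. -/
abbrev Request : Type := Fin I.numRequests

/-- The underlying bipartite graph, with vertex set the disjoint union of servers and requests. -/
def graph : SimpleGraph (I.Server ⊕ I.Request) where
  Adj
    | Sum.inl s, Sum.inr r => I.Edge s r
    | Sum.inr r, Sum.inl s => I.Edge s r
    | Sum.inl _, Sum.inl _ => False
    | Sum.inr _, Sum.inr _ => False
  symm := ⟨by rintro (a | a) (b | b) h <;> exact h⟩
  loopless := ⟨by rintro (a | a) h <;> exact h⟩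

open scoped Classical in
/-- Every server and every request has degree exactly `d`. -/
def IsRegular (d : ℕ) : Prop := I.graph.IsRegularOfDegree d

/-- The size of a maximum matching of the underlying graph. -/
noncomputable def opt : ℕ :=
  sSup {k : ℕ | ∃ M : I.graph.Subgraph, M.IsMatching ∧ M.edgeSet.ncard = k}

open scoped Classical in
/-- The unmatched neighbors of the request `r`, when `M` is the set of pairs matched so far. -/
noncomputable def available (M : Finset (I.Server × I.Request)) (r : I.Request) :
    Finset I.Server :=
  Finset.univ.filter fun s => I.Edge s r ∧ ∀ r', (s, r') ∉ M

open scoped Classical in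
/-- The unmatched neighbors of the request `r` that have the smallest rank among these. There is at
most one if all ranks are different, which happens with probability one. -/
noncomputable def best (y : I.Server → ℝ) (M : Finset (I.Server × I.Request)) (r : I.Request) :
    Finset I.Server :=
  (I.available M r).filter fun s => ∀ t ∈ I.available M r, y s ≤ y t

open scoped Classical in
/-- One round of Ranking with ranks `y`: the arriving request `r` is matched to an unmatched
neighbor of the smallest rank, if there is an unmatched neighbor (a tie goes to the smallest
index). -/
noncomputable def rankingStep (y : I.Server → ℝ) (M : Finset (I.Server × I.Request))
    (r : I.Request) : Finset (I.Server × I.Request) :=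
  if h : (I.best y M r).Nonempty then insert ((I.best y M r).min' h, r) M else M

/-- The matching that Ranking with ranks `y` computes when the requests arrive in their order. -/
noncomputable def rankingMatching (y : I.Server → ℝ) : Finset (I.Server × I.Request) :=
  (List.finRange I.numRequests).foldl (I.rankingStep y) ∅

/-- The law of the ranks: independent and uniform on `[0, 1]`. -/
noncomputable def rankLaw : Measure (I.Server → ℝ) :=
  Measure.pi fun _ => volume.restrict (Set.Icc (0 : ℝ) 1)

/-- The expected size of the matching that Ranking computes. -/
noncomputable def expectedRanking : ℝ :=
  ∫ y, ((I.rankingMatching y).card : ℝ) ∂I.rankLaw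

instance : IsProbabilityMeasure I.rankLaw := by
  have : IsProbabilityMeasure ((volume : Measure ℝ).restrict (Set.Icc (0 : ℝ) 1)) :=
    ⟨by simp⟩
  unfold rankLaw
  infer_instance

/-- The run of Ranking depends only on the comparisons between the ranks. -/
lemma rankingMatching_congr {y z : I.Server → ℝ} (h : ∀ s t, y s ≤ y t ↔ z s ≤ z t) :
    I.rankingMatching y = I.rankingMatching z := by
  have hstep : I.rankingStep y = I.rankingStep z := by
    funext M r
    have hb : I.best y M r = I.best z M r := by
      unfold best
      simp only [h]
    unfold rankingStep
    simp only [hb]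
  unfold rankingMatching
  rw [hstep]

lemma measurable_card_rankingMatching :
    Measurable fun y : I.Server → ℝ => ((I.rankingMatching y).card : ℝ) := by
  let p : (I.Server → ℝ) → (I.Server → I.Server → Prop) := fun y s t => y s ≤ y t
  have hp : Measurable p := by
    refine measurable_pi_lambda _ fun s => measurable_pi_lambda _ fun t => ?_
    exact (measurableSet_le (measurable_pi_apply s) (measurable_pi_apply t)).mem
  have hf : Function.FactorsThrough
      (fun y : I.Server → ℝ => ((I.rankingMatching y).card : ℝ)) p := by
    intro y z hyz
    have h : ∀ s t, y s ≤ y t ↔ z s ≤ z t := fun s t => iff_of_eq (congrFun (congrFun hyz s) t)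
    simp only [I.rankingMatching_congr h]
  rw [← hf.extend_comp (fun _ => (0 : ℝ))]
  exact (Measurable.of_discrete).comp hp

/-- The expectation above is that of an integrable random variable. -/
lemma integrable_card_rankingMatching :
    Integrable (fun y => ((I.rankingMatching y).card : ℝ)) I.rankLaw := by
  refine Integrable.of_bound I.measurable_card_rankingMatching.aestronglyMeasurable
    (Fintype.card (I.Server × I.Request) : ℝ) (Filter.Eventually.of_forall fun y => ?_)
  rw [Real.norm_natCast]
  exact_mod_cast Finset.card_le_univ _

end OnlineInstance

/-- The competitive ratio of Ranking on `d`-regular graphs: the infimum of `E[ALG] / OPT` over all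
online instances whose graph is `d`-regular (and for which the quotient makes sense). -/
noncomputable def rankingCompetitiveRatio (d : ℕ) : ℝ :=
  sInf {ρ : ℝ | ∃ I : OnlineInstance, I.IsRegular d ∧ 0 < I.opt ∧ ρ = I.expectedRanking / I.opt}

/-- The instance with servers and requests `0, …, 2d - 2`. The first `d` servers form `S₁`, the
others `S₂`; the first `d` requests form `R₁`, the others `R₂`. The edges join `i ∈ S₁` with
`i ∈ R₁`, all of `S₂` with all of `R₁`, and all of `S₁` with all of `R₂`. -/
def hardInstance (d : ℕ) : OnlineInstance where
  numServers := 2 * d - 1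
  numRequests := 2 * d - 1
  Edge s r :=
    ((s : ℕ) < d ∧ (r : ℕ) < d ∧ (s : ℕ) = r) ∨ (d ≤ (s : ℕ) ∧ (r : ℕ) < d) ∨
      ((s : ℕ) < d ∧ d ≤ (r : ℕ))

/-- The bound `1 - (d - 1) / (2 d - 1) * (1 - 1 / d) ^ d`. -/
noncomputable def rankingBound (d : ℕ) : ℝ :=
  1 - ((d : ℝ) - 1) / (2 * (d : ℝ) - 1) * (1 - 1 / (d : ℝ)) ^ d

/-!
The bound comes from the run of Ranking on the hard instance. Call the servers in `S₁` private and
those in `S₂` shared, the requests in `R₁` early and those in `R₂` late. An early request always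
finds its private server free, and takes a shared server only if the best free one beats the private
one. Late requests never touch shared servers. So the matching has at most `d` edges plus the number
of shared servers taken in the early rounds (`card_rankingMatching_le`), and it remains to show that
at least `(d - 1) (1 - 1 / d) ^ d` shared servers stay free on average (`le_integral_freeMean`).

The shared servers are taken in the order of their ranks. If `k` of them are in use, then the next
early request, whose private server has a fresh uniform rank `x`, takes another one precisely when
more than `k` shared ranks are at most `x`. Hence the number in use depends on the shared ranks only
through a counting function, which is symmetric in the servers (`advance`, `freeMean`).

Suppose that `m + 1` shared servers are free, that the smallest of their ranks is `v` and that the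
others are independent and uniform on `(v, 1]`, and put `q = (1 - v) / (m + 1)`. The next request
takes a shared server with probability `1 - v`, which lowers the number of free ones by the factor
`1 - q` on average. When the smallest rank is taken, the conditional mean of the new `q` is the old
one, so by Jensen's inequality the mean of `(1 - q) ^ t` does not drop (`jensen_smallest_rank`). By
induction on `t`, at least `(m + 1) (1 - q) ^ t` shared servers are free on average after `t` rounds
(`le_integral_freeMean_insertNth`). One more use of Jensen's inequality, with `d - 1` uniform ranks
at the start and `1 / d` for the mean of `q`, gives the claim.
-/

/-! ### Splitting an integral over a cube by the position of the smallest coordinate -/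

/-- The product of the Lebesgue measures on `(v, 1]`, over `n` coordinates. It is not normalized:
its mass is `(1 - v) ^ n`. -/
noncomputable def cubeAbove (n : ℕ) (v : ℝ) : Measure (Fin n → ℝ) :=
  Measure.pi fun _ => volume.restrict (Set.Ioc v 1)

instance (n : ℕ) (v : ℝ) : IsFiniteMeasure (cubeAbove n v) := by
  unfold cubeAbove
  infer_instance

lemma cubeAbove_real_univ (n : ℕ) {v : ℝ} (hv : v ≤ 1) :
    (cubeAbove n v).real Set.univ = (1 - v) ^ n := by
  simp [cubeAbove, Measure.real, Measure.pi_univ, hv]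

lemma ae_lt_cubeAbove (n : ℕ) (v : ℝ) : ∀ᵐ y ∂cubeAbove n v, ∀ j, v < y j := by
  rw [ae_all_iff]
  intro j
  have h : ∀ᵐ x ∂(volume.restrict (Set.Ioc v 1)), v < x := by
    filter_upwards [ae_restrict_mem measurableSet_Ioc] with x hx using hx.1
  exact (Measure.quasiMeasurePreserving_eval
    (fun _ : Fin n => (volume : Measure ℝ).restrict (Set.Ioc v 1)) j).ae h

lemma cubeAbove_restrict_Ioi (n : ℕ) {u v : ℝ} (h : v ≤ u) :
    (cubeAbove n v).restrict (Set.univ.pi fun _ => Set.Ioi u) = cubeAbove n u := by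
  unfold cubeAbove
  rw [Measure.restrict_pi_pi]
  congr 1
  funext j
  rw [Measure.restrict_restrict measurableSet_Ioi]
  congr 1
  ext x
  simp only [Set.mem_inter_iff, Set.mem_Ioi, Set.mem_Ioc]
  constructor
  · rintro ⟨h1, -, h2⟩
    exact ⟨h1, h2⟩
  · rintro ⟨h1, h2⟩
    exact ⟨h1, h.trans_lt h1, h2⟩

/-- The part of an integral over a cube on which the coordinate `b` is the strict minimum, as an
iterated integral: over the value `u` of this coordinate, then over the others, all above `u`. -/
lemma setIntegral_strict_min {m : ℕ} {f : (Fin (m + 1) → ℝ) → ℝ} {v : ℝ}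
    (hf : Integrable f (cubeAbove (m + 1) v)) (b : Fin (m + 1)) :
    IntegrableOn (fun u => ∫ y, f (b.insertNth u y) ∂cubeAbove m u) (Set.Ioc v 1) ∧
    ∫ y in {y | ∀ j, y b < y (b.succAbove j)}, f y ∂cubeAbove (m + 1) v =
      ∫ u in Set.Ioc v 1, ∫ y, f (b.insertNth u y) ∂cubeAbove m u := by
  set e := MeasurableEquiv.piFinSuccAbove (fun _ : Fin (m + 1) => ℝ) b with he
  have hmp : MeasurePreserving e (cubeAbove (m + 1) v)
      ((volume.restrict (Set.Ioc v 1)).prod (cubeAbove m v)) :=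
    measurePreserving_piFinSuccAbove
      (fun _ : Fin (m + 1) => (volume : Measure ℝ).restrict (Set.Ioc v 1)) b
  let A : Set (ℝ × (Fin m → ℝ)) := {z | ∀ j, z.1 < z.2 j}
  have hA : MeasurableSet A := by
    simp only [A, Set.ofPred_forall]
    exact MeasurableSet.iInter fun j =>
      measurableSet_lt measurable_fst ((measurable_pi_apply j).comp measurable_snd)
  have hsymm : ∀ z : ℝ × (Fin m → ℝ), e.symm z = b.insertNth z.1 z.2 := fun z => rfl
  have hpre : {y : Fin (m + 1) → ℝ | ∀ j, y b < y (b.succAbove j)} = e ⁻¹' A := rfl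
  have hint : Integrable (fun z => f (e.symm z))
      ((volume.restrict (Set.Ioc v 1)).prod (cubeAbove m v)) :=
    hmp.symm.integrable_comp_of_integrable hf
  have hintA := hint.indicator hA
  have hinner : ∀ u ∈ Set.Ioc v 1,
      ∫ y, A.indicator (fun z => f (e.symm z)) (u, y) ∂cubeAbove m v =
        ∫ y, f (b.insertNth u y) ∂cubeAbove m u := by
    intro u hu
    have hB : MeasurableSet (Set.univ.pi fun _ : Fin m => Set.Ioi u) :=
      MeasurableSet.univ_pi fun _ => measurableSet_Ioi
    rw [← cubeAbove_restrict_Ioi m hu.1.le, ← integral_indicator hB]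
    refine integral_congr_ae (Filter.Eventually.of_forall fun y => ?_)
    by_cases hy : ∀ j, u < y j
    · have h1 : (u, y) ∈ A := hy
      have h2 : y ∈ Set.univ.pi fun _ : Fin m => Set.Ioi u := fun j _ => hy j
      simp only [Set.indicator_of_mem h1, Set.indicator_of_mem h2, hsymm]
    · have h1 : (u, y) ∉ A := hy
      have h2 : y ∉ Set.univ.pi fun _ : Fin m => Set.Ioi u := fun h => hy fun j => h j trivial
      simp only [Set.indicator_of_notMem h1, Set.indicator_of_notMem h2]
  constructor
  · exact (integrable_congr (by
      filter_upwards [ae_restrict_mem measurableSet_Ioc] with u hu using hinner u hu)).1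
      hintA.integral_prod_left
  · have h1 := hmp.setIntegral_preimage_emb e.measurableEmbedding (fun z => f (e.symm z)) A
    simp only [MeasurableEquiv.symm_apply_apply] at h1
    rw [hpre, h1, ← integral_indicator hA, integral_prod _ hintA]
    exact setIntegral_congr_fun measurableSet_Ioc hinner

/-- A nonnegative function is integrated over a cube by the position and the value of the smallest
coordinate; points with ties only help. -/
lemma mul_setIntegral_le_integral_cubeAbove {m : ℕ} {f : (Fin (m + 1) → ℝ) → ℝ} {v : ℝ}
    (hf : Integrable f (cubeAbove (m + 1) v)) (hf0 : ∀ y, 0 ≤ f y) {g : ℝ → ℝ}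
    (hg : IntegrableOn g (Set.Ioc v 1))
    (h : ∀ u ∈ Set.Ioc v 1, ∀ b : Fin (m + 1),
      g u ≤ ∫ y, f (b.insertNth u y) ∂cubeAbove m u) :
    ((m : ℝ) + 1) * ∫ u in Set.Ioc v 1, g u ≤ ∫ y, f y ∂cubeAbove (m + 1) v := by
  let S : Fin (m + 1) → Set (Fin (m + 1) → ℝ) := fun b => {y | ∀ j, y b < y (b.succAbove j)}
  have hS : ∀ b, MeasurableSet (S b) := by
    intro b
    simp only [S, Set.ofPred_forall]
    exact MeasurableSet.iInter fun j =>
      measurableSet_lt (measurable_pi_apply _) (measurable_pi_apply _)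
  have hdisj : Pairwise (Function.onFun Disjoint S) := by
    intro b c hbc
    refine Set.disjoint_left.2 fun y hb hc => ?_
    obtain ⟨i, hi⟩ := Fin.exists_succAbove_eq hbc
    obtain ⟨j, hj⟩ := Fin.exists_succAbove_eq hbc.symm
    have h1 := hb j
    have h2 := hc i
    rw [hj] at h1
    rw [hi] at h2
    exact lt_asymm h1 h2
  calc ((m : ℝ) + 1) * ∫ u in Set.Ioc v 1, g u
      = ∑ _b : Fin (m + 1), ∫ u in Set.Ioc v 1, g u := by simp
    _ ≤ ∑ b : Fin (m + 1), ∫ y in S b, f y ∂cubeAbove (m + 1) v := by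
        refine Finset.sum_le_sum fun b _ => ?_
        obtain ⟨hi, he⟩ := setIntegral_strict_min hf b
        rw [he]
        exact setIntegral_mono_on hg hi measurableSet_Ioc fun u hu => h u hu b
    _ = ∫ y in ⋃ b, S b, f y ∂cubeAbove (m + 1) v :=
        (integral_iUnion_fintype hS hdisj fun b => hf.integrableOn).symm
    _ ≤ ∫ y, f y ∂cubeAbove (m + 1) v :=
        setIntegral_le_integral hf (Filter.Eventually.of_forall hf0)

/-! ### Jensen's inequality for the smallest of several uniform ranks -/

lemma pow_tangent_le {a s : ℝ} (ha : 0 ≤ a) (hs : 0 ≤ s) (t : ℕ) :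
    a ^ t + t * a ^ (t - 1) * (s - a) ≤ s ^ t := by
  rcases ha.eq_or_lt with rfl | ha
  · rcases t with _ | _ | t <;> simp [hs]
  · rcases t with _ | t
    · simp
    have h := one_add_mul_le_pow (a := s / a - 1) (by linarith [div_nonneg hs ha.le]) (t + 1)
    have h2 := mul_le_mul_of_nonneg_left h (pow_pos ha (t + 1)).le
    rw [← mul_pow] at h2
    have h3 : a * (1 + (s / a - 1)) = s := by field_simp; ring
    rw [h3] at h2
    refine le_trans (le_of_eq ?_) h2
    simp only [Nat.add_sub_cancel]
    push_cast
    field_simp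
    ring

/-- Jensen's inequality for the convex function `(1 - x) ^ t` and `x = (1 - u) / (m + 1)`, where `u`
has density `(m + 1) (1 - u) ^ m / (1 - v) ^ (m + 1)` on `[v, 1]`. -/
lemma jensen_smallest_rank (m t : ℕ) {v : ℝ} (hv0 : 0 ≤ v) (hv : v ≤ 1) :
    (1 - v) ^ (m + 1) * (1 - (1 - v) / (m + 2)) ^ t ≤
      (m + 1) * ∫ u in Set.Ioc v 1, (1 - u) ^ m * (1 - (1 - u) / (m + 1)) ^ t := by
  set a : ℝ := 1 - (1 - v) / (m + 2) with ha
  have ha0 : 0 ≤ a := by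
    have : (1 - v) / ((m : ℝ) + 2) ≤ 1 := by
      rw [div_le_one (by positivity)]
      have : (0 : ℝ) ≤ m := m.cast_nonneg
      linarith
    linarith
  set c : ℝ := t * a ^ (t - 1) with hc
  have hlow : ∫ u in Set.Ioc v 1,
      ((a ^ t + c * (1 - a)) * (1 - u) ^ m - c / (m + 1) * (1 - u) ^ (m + 1)) ≤
      ∫ u in Set.Ioc v 1, (1 - u) ^ m * (1 - (1 - u) / (m + 1)) ^ t := by
    refine setIntegral_mono_on ?_ ?_ measurableSet_Ioc ?_
    · exact (Continuous.integrableOn_Icc (by fun_prop)).mono_set Set.Ioc_subset_Icc_self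
    · exact (Continuous.integrableOn_Icc (by fun_prop)).mono_set Set.Ioc_subset_Icc_self
    · intro u hu
      have h1 : (0 : ℝ) ≤ 1 - u := by linarith [hu.2]
      have h2 : (0 : ℝ) ≤ 1 - (1 - u) / (m + 1) := by
        have : (1 - u) / ((m : ℝ) + 1) ≤ 1 := by
          rw [div_le_one (by positivity)]
          have : (0 : ℝ) ≤ m := m.cast_nonneg
          linarith [hu.1]
        linarith
      have h3 := mul_le_mul_of_nonneg_left (pow_tangent_le ha0 h2 t) (pow_nonneg h1 m)
      refine le_trans (le_of_eq ?_) h3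
      rw [← hc]
      field_simp
      ring
  have hint : ∀ k : ℕ, ∫ u in v..1, (1 - u) ^ k = (1 - v) ^ (k + 1) / (k + 1) := by
    intro k
    rw [intervalIntegral.integral_comp_sub_left (fun x => x ^ k) 1]
    simp
  rw [← intervalIntegral.integral_of_le hv, intervalIntegral.integral_sub
    (Continuous.intervalIntegrable (by fun_prop) _ _)
    (Continuous.intervalIntegrable (by fun_prop) _ _), intervalIntegral.integral_const_mul,
    intervalIntegral.integral_const_mul, hint, hint] at hlow
  refine le_trans (le_of_eq ?_) (mul_le_mul_of_nonneg_left hlow (by positivity))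
  have h1a : 1 - a = (1 - v) / (m + 2) := by rw [ha]; ring
  rw [h1a]
  push_cast
  have e2 : (m : ℝ) + 1 + 1 = m + 2 := by ring
  rw [e2]
  field_simp
  ring

/-! ### The chain that counts the shared servers in use -/

/-- The number of entries of `y` that are at most `x`. -/
noncomputable def countLE {n : ℕ} (y : Fin n → ℝ) (x : ℝ) : ℕ := ∑ j, if y j ≤ x then 1 else 0

/-- The number of shared servers in use after a request arrives whose private server has rank `x`,
when the shared servers have ranks `y` and the `k` best of them are in use: the request takes the
next one if its rank is at most `x`. -/
noncomputable def advance {n : ℕ} (y : Fin n → ℝ) (k : ℕ) (x : ℝ) : ℕ :=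
  if k < countLE y x then k + 1 else k

/-- The probability that a private server of uniform rank lets the chain `advance` leave `k`. -/
noncomputable def advanceProb {n : ℕ} (y : Fin n → ℝ) (k : ℕ) : ℝ :=
  (volume.restrict (Set.Ioc (0 : ℝ) 1)).real {x | k < countLE y x}

/-- The expected value, after `t` rounds from `k`, of the chain on `ℕ` that moves from `j` to `j + 1`
with probability `p j` and stays at `j` otherwise. -/
def chainMean (p : ℕ → ℝ) : ℕ → ℕ → ℝ
  | 0, k => k
  | t + 1, k => (1 - p k) * chainMean p t k + p k * chainMean p t (k + 1)

lemma chainMean_succ_start (p : ℕ → ℝ) (t k : ℕ) :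
    chainMean p t (k + 1) = 1 + chainMean (fun j => p (j + 1)) t k := by
  induction t generalizing k with
  | zero => simp [chainMean, add_comm]
  | succ t ih =>
    simp only [chainMean, ih]
    ring

lemma chainMean_le {p : ℕ → ℝ} (h0 : ∀ k, 0 ≤ p k) (h1 : ∀ k, p k ≤ 1) {n : ℕ} (hn : p n = 0)
    (t : ℕ) {k : ℕ} (hk : k ≤ n) : chainMean p t k ≤ n := by
  induction t generalizing k with
  | zero => simpa [chainMean] using hk
  | succ t ih =>
    simp only [chainMean]
    rcases hk.eq_or_lt with rfl | hk
    · simpa [hn] using ih le_rfl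
    · have a1 := mul_le_mul_of_nonneg_left (ih hk.le) (sub_nonneg.2 (h1 k))
      have a2 := mul_le_mul_of_nonneg_left (ih hk) (h0 k)
      linarith

lemma chainMean_nonneg {p : ℕ → ℝ} (h0 : ∀ k, 0 ≤ p k) (h1 : ∀ k, p k ≤ 1) (t k : ℕ) :
    0 ≤ chainMean p t k := by
  induction t generalizing k with
  | zero => simp [chainMean]
  | succ t ih =>
    exact add_nonneg (mul_nonneg (sub_nonneg.2 (h1 k)) (ih k)) (mul_nonneg (h0 k) (ih (k + 1)))

lemma measurable_countLE {n : ℕ} :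
    Measurable fun z : (Fin n → ℝ) × ℝ => countLE z.1 z.2 := by
  unfold countLE
  refine Finset.measurable_sum _ fun j _ => Measurable.ite ?_ measurable_const measurable_const
  exact measurableSet_le ((measurable_pi_apply j).comp measurable_fst) measurable_snd

lemma measurableSet_lt_countLE {n : ℕ} (k : ℕ) :
    MeasurableSet {z : (Fin n → ℝ) × ℝ | k < countLE z.1 z.2} :=
  measurableSet_lt measurable_const measurable_countLE

lemma countLE_le {n : ℕ} (y : Fin n → ℝ) (x : ℝ) : countLE y x ≤ n := by
  unfold countLE
  refine (Finset.sum_le_card_nsmul _ _ 1 fun j _ => ?_).trans (by simp)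
  split_ifs <;> simp

lemma advanceProb_nonneg {n : ℕ} (y : Fin n → ℝ) (k : ℕ) : 0 ≤ advanceProb y k :=
  measureReal_nonneg

instance isProbabilityMeasure_restrict_Ioc_zero_one :
    IsProbabilityMeasure ((volume : Measure ℝ).restrict (Set.Ioc 0 1)) :=
  ⟨by simp⟩

lemma advanceProb_le_one {n : ℕ} (y : Fin n → ℝ) (k : ℕ) : advanceProb y k ≤ 1 :=
  measureReal_le_one

lemma advanceProb_self {n : ℕ} (y : Fin n → ℝ) : advanceProb y n = 0 := by
  have : {x | n < countLE y x} = ∅ := by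
    ext x
    simpa using countLE_le y x
  simp [advanceProb, this]

lemma measurable_advanceProb {n : ℕ} (k : ℕ) :
    Measurable fun y : Fin n → ℝ => advanceProb y k :=
  (measurable_measure_prodMk_left (measurableSet_lt_countLE k)).ennreal_toReal

lemma measurable_chainMean_advanceProb {n : ℕ} (t k : ℕ) :
    Measurable fun y : Fin n → ℝ => chainMean (advanceProb y) t k := by
  induction t generalizing k with
  | zero => exact measurable_const
  | succ t ih =>
    exact ((measurable_const.sub (measurable_advanceProb k)).mul (ih k)).add
      ((measurable_advanceProb k).mul (ih (k + 1)))

lemma chainMean_advanceProb_mem {n : ℕ} (y : Fin n → ℝ) (t : ℕ) :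
    chainMean (advanceProb y) t 0 ∈ Set.Icc (0 : ℝ) n :=
  ⟨chainMean_nonneg (advanceProb_nonneg y) (advanceProb_le_one y) t 0,
    chainMean_le (advanceProb_nonneg y) (advanceProb_le_one y) (advanceProb_self y) t n.zero_le⟩

lemma integrable_chainMean_advanceProb {n : ℕ} (t : ℕ) (μ : Measure (Fin n → ℝ))
    [IsFiniteMeasure μ] : Integrable (fun y => chainMean (advanceProb y) t 0) μ := by
  refine Integrable.of_bound (measurable_chainMean_advanceProb t 0).aestronglyMeasurable n
    (Filter.Eventually.of_forall fun y => ?_)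
  obtain ⟨h0, h1⟩ := chainMean_advanceProb_mem y t
  rwa [Real.norm_of_nonneg h0]

lemma measurable_foldl_advance {n : ℕ} (y : Fin n → ℝ) (t k : ℕ) :
    Measurable fun x : Fin t → ℝ => (List.ofFn x).foldl (advance y) k := by
  induction t generalizing k with
  | zero => simp
  | succ t ih =>
    simp only [List.ofFn_succ, List.foldl_cons]
    have htail : Measurable fun (x : Fin (t + 1) → ℝ) (i : Fin t) => x i.succ :=
      measurable_pi_lambda _ fun i => measurable_pi_apply _
    have hset : MeasurableSet {x : Fin (t + 1) → ℝ | k < countLE y (x 0)} :=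
      (measurableSet_lt_countLE k).preimage (measurable_const.prodMk (measurable_pi_apply 0))
    have h : (fun x : Fin (t + 1) → ℝ =>
        (List.ofFn fun i : Fin t => x i.succ).foldl (advance y) (advance y k (x 0))) =
        fun x => if k < countLE y (x 0)
          then (List.ofFn fun i : Fin t => x i.succ).foldl (advance y) (k + 1)
          else (List.ofFn fun i : Fin t => x i.succ).foldl (advance y) k := by
      funext x
      simp only [advance]
      split_ifs <;> rfl
    rw [h]
    exact Measurable.ite hset ((ih (k + 1)).comp htail) ((ih k).comp htail)

lemma foldl_advance_le {n : ℕ} (y : Fin n → ℝ) (l : List ℝ) (k : ℕ) :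
    l.foldl (advance y) k ≤ k + l.length := by
  induction l generalizing k with
  | nil => simp
  | cons x l ih =>
    refine (ih _).trans ?_
    simp only [advance, List.length_cons]
    split_ifs <;> omega

lemma integrable_foldl_advance {n : ℕ} (y : Fin n → ℝ) (t k : ℕ) (μ : Measure (Fin t → ℝ))
    [IsFiniteMeasure μ] :
    Integrable (fun x => (((List.ofFn x).foldl (advance y) k : ℕ) : ℝ)) μ := by
  refine Integrable.of_bound
    (measurable_from_top.comp (measurable_foldl_advance y t k)).aestronglyMeasurable (k + t)
    (Filter.Eventually.of_forall fun x => ?_)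
  rw [Real.norm_natCast]
  exact_mod_cast (foldl_advance_le y _ k).trans (by simp)

/-- When the private servers have independent uniform ranks, `advance` is the chain with transition
probabilities `advanceProb`. -/
lemma integral_foldl_advance {n : ℕ} (y : Fin n → ℝ) (t k : ℕ) :
    ∫ x, (((List.ofFn x).foldl (advance y) k : ℕ) : ℝ) ∂cubeAbove t 0 =
      chainMean (advanceProb y) t k := by
  induction t generalizing k with
  | zero => simp [chainMean, cubeAbove_real_univ]
  | succ t ih =>
    set e := MeasurableEquiv.piFinSuccAbove (fun _ : Fin (t + 1) => ℝ) 0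
    have hmp : MeasurePreserving e (cubeAbove (t + 1) 0)
        ((volume.restrict (Set.Ioc 0 1)).prod (cubeAbove t 0)) :=
      measurePreserving_piFinSuccAbove
        (fun _ : Fin (t + 1) => (volume : Measure ℝ).restrict (Set.Ioc 0 1)) 0
    have hint : Integrable
        (fun z => (((List.ofFn (e.symm z)).foldl (advance y) k : ℕ) : ℝ))
        ((volume.restrict (Set.Ioc 0 1)).prod (cubeAbove t 0)) := hmp.symm.integrable_comp_of_integrable
      (integrable_foldl_advance y (t + 1) k (cubeAbove (t + 1) 0))
    have hcomp := hmp.symm.integral_comp'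
      (fun x => (((List.ofFn x).foldl (advance y) k : ℕ) : ℝ))
    rw [← hcomp, integral_prod _ hint]
    have hset : MeasurableSet {x | k < countLE y x} :=
      (measurableSet_lt_countLE k).preimage (measurable_const.prodMk measurable_id)
    have hinner : ∀ a : ℝ,
        ∫ x, (((List.ofFn (e.symm (a, x))).foldl (advance y) k : ℕ) : ℝ) ∂cubeAbove t 0 =
          chainMean (advanceProb y) t k + {x | k < countLE y x}.indicator
            (fun _ => chainMean (advanceProb y) t (k + 1) - chainMean (advanceProb y) t k) a := by
      intro a
      have h : ∀ x : Fin t → ℝ, List.ofFn (e.symm (a, x)) = a :: List.ofFn x := by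
        intro x
        rw [List.ofFn_succ]
        rfl
      simp only [h, List.foldl_cons]
      rw [ih]
      by_cases ha : k < countLE y a <;> simp [advance, ha]
    simp only [hinner]
    rw [integral_add (integrable_const _) ((integrable_const _).indicator hset),
      integral_indicator hset]
    simp only [integral_const, smul_eq_mul, measureReal_restrict_apply MeasurableSet.univ,
      Set.univ_inter, chainMean]
    rw [show (volume.restrict (Set.Ioc (0 : ℝ) 1)).real {x | k < countLE y x} = advanceProb y k
      from rfl]
    simp
    ring

lemma countLE_insertNth {m : ℕ} (b : Fin (m + 1)) (v : ℝ) (y : Fin m → ℝ) (x : ℝ) :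
    countLE (b.insertNth v y : Fin (m + 1) → ℝ) x = (if v ≤ x then 1 else 0) + countLE y x := by
  simp [countLE, Fin.sum_univ_succAbove _ b]

lemma countLE_eq_zero {m : ℕ} {y : Fin m → ℝ} {x : ℝ} (h : ∀ j, x < y j) : countLE y x = 0 := by
  simp [countLE, h]

lemma advanceProb_insertNth_zero {m : ℕ} (b : Fin (m + 1)) {v : ℝ} (hv0 : 0 ≤ v) (hv : v ≤ 1)
    {y : Fin m → ℝ} (hy : ∀ j, v < y j) :
    advanceProb (b.insertNth v y : Fin (m + 1) → ℝ) 0 = 1 - v := by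
  have h : {x | 0 < countLE (b.insertNth v y : Fin (m + 1) → ℝ) x} = Set.Ici v := by
    ext x
    rw [Set.mem_ofPred_eq, countLE_insertNth, Set.mem_Ici]
    by_cases hx : v ≤ x
    · simp [hx]
    · have : countLE y x = 0 := countLE_eq_zero fun j => (not_le.1 hx).trans (hy j)
      simp [hx, this]
  rw [advanceProb, h, measureReal_restrict_apply measurableSet_Ici, measureReal_congr
    (Filter.EventuallyEq.rfl.inter Ioc_ae_eq_Icc), ← Set.Ici_inter_Iic, ← Set.inter_assoc,
    Set.Ici_inter_Ici, sup_eq_left.2 hv0, Set.Ici_inter_Iic]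
  simp [hv]

lemma advanceProb_insertNth_succ {m : ℕ} (b : Fin (m + 1)) {v : ℝ}
    {y : Fin m → ℝ} (hy : ∀ j, v < y j) (k : ℕ) :
    advanceProb (b.insertNth v y : Fin (m + 1) → ℝ) (k + 1) = advanceProb y k := by
  unfold advanceProb
  congr 1
  ext x
  rw [Set.mem_ofPred_eq, countLE_insertNth, Set.mem_ofPred_eq]
  by_cases hx : v ≤ x
  · simp only [hx, if_true]
    omega
  · have : countLE y x = 0 := countLE_eq_zero fun j => (not_le.1 hx).trans (hy j)
    simp [hx, this]

/-! ### The expected number of shared servers that stay free -/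

/-- The expected number of shared servers still free after `t` rounds, given their ranks `y`. -/
noncomputable def freeMean {n : ℕ} (t : ℕ) (y : Fin n → ℝ) : ℝ :=
  n - chainMean (advanceProb y) t 0

lemma freeMean_nonneg {n : ℕ} (t : ℕ) (y : Fin n → ℝ) : 0 ≤ freeMean t y :=
  sub_nonneg.2 (chainMean_advanceProb_mem y t).2

lemma integrable_freeMean {n : ℕ} (t : ℕ) (μ : Measure (Fin n → ℝ)) [IsFiniteMeasure μ] :
    Integrable (freeMean t) μ :=
  (integrable_const _).sub (integrable_chainMean_advanceProb t μ)

/-- The smallest rank `v` is taken in the first round with probability `1 - v`, and then plays no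
role in the rounds that follow. -/
lemma freeMean_succ_insertNth {m : ℕ} (t : ℕ) (b : Fin (m + 1)) {v : ℝ} (hv0 : 0 ≤ v)
    (hv : v ≤ 1) {y : Fin m → ℝ} (hy : ∀ j, v < y j) :
    freeMean (t + 1) (b.insertNth v y : Fin (m + 1) → ℝ) =
      v * freeMean t (b.insertNth v y : Fin (m + 1) → ℝ) + (1 - v) * freeMean t y := by
  have h : (fun j => advanceProb (b.insertNth v y : Fin (m + 1) → ℝ) (j + 1)) = advanceProb y :=
    funext fun j => advanceProb_insertNth_succ b hy j
  simp only [freeMean, chainMean, chainMean_succ_start, h,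
    advanceProb_insertNth_zero b hv0 hv hy]
  push_cast
  ring

/-- From a bound when the smallest of `m` ranks is known to one when all of them are random. -/
lemma le_integral_freeMean_of_min_known (t : ℕ)
    (h : ∀ (m : ℕ) (v : ℝ), 0 ≤ v → v ≤ 1 → ∀ b : Fin (m + 1),
      (1 - v) ^ m * (m + 1) * (1 - (1 - v) / (m + 1)) ^ t ≤
        ∫ y, freeMean t (b.insertNth v y : Fin (m + 1) → ℝ) ∂cubeAbove m v)
    (m : ℕ) {v : ℝ} (hv0 : 0 ≤ v) (hv : v ≤ 1) :
    (1 - v) ^ m * m * (1 - (1 - v) / (m + 1)) ^ t ≤ ∫ y, freeMean t y ∂cubeAbove m v := by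
  rcases m with _ | m
  · simpa using integral_nonneg fun y => freeMean_nonneg t y
  · have h1 := mul_setIntegral_le_integral_cubeAbove
      (g := fun u => (m + 1) * ((1 - u) ^ m * (1 - (1 - u) / (m + 1)) ^ t))
      (integrable_freeMean t (cubeAbove (m + 1) v)) (freeMean_nonneg t)
      ((Continuous.integrableOn_Icc (by fun_prop)).mono_set Set.Ioc_subset_Icc_self)
      (fun u hu b => (le_of_eq (by ring)).trans (h m u (hv0.trans hu.1.le) hu.2 b))
    refine le_trans ?_ h1
    have h2 := mul_le_mul_of_nonneg_left (jensen_smallest_rank m t hv0 hv)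
      (by positivity : (0 : ℝ) ≤ m + 1)
    rw [integral_const_mul]
    refine le_trans (le_of_eq ?_) h2
    push_cast
    rw [show (m : ℝ) + 1 + 1 = m + 2 by ring]
    ring

/-- If the smallest of `m + 1` ranks is `v` and the others are uniform above it, then after `t`
rounds at least `(m + 1) (1 - q) ^ t` shared servers are free on average, where
`q = (1 - v) / (m + 1)`. The ratio `q` is a martingale under the run of the algorithm. -/
lemma le_integral_freeMean_insertNth (t m : ℕ) {v : ℝ} (hv0 : 0 ≤ v) (hv : v ≤ 1)
    (b : Fin (m + 1)) :
    (1 - v) ^ m * (m + 1) * (1 - (1 - v) / (m + 1)) ^ t ≤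
      ∫ y, freeMean t (b.insertNth v y : Fin (m + 1) → ℝ) ∂cubeAbove m v := by
  induction t generalizing m v with
  | zero => simp [freeMean, chainMean, cubeAbove_real_univ m hv]
  | succ t ih =>
    have hB := le_integral_freeMean_of_min_known t (fun m v h0 h1 b => ih m h0 h1 b) m hv0 hv
    have hA := ih m hv0 hv b
    have hins : Measurable fun y : Fin m → ℝ => (b.insertNth v y : Fin (m + 1) → ℝ) :=
      (MeasurableEquiv.piFinSuccAbove (fun _ : Fin (m + 1) => ℝ) b).symm.measurable.comp
        (measurable_const.prodMk measurable_id)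
    have hintA : Integrable (fun y => freeMean t (b.insertNth v y : Fin (m + 1) → ℝ))
        (cubeAbove m v) :=
      (integrable_freeMean t ((cubeAbove m v).map _)).comp_measurable hins
    rw [integral_congr_ae (g := fun y => v * freeMean t (b.insertNth v y : Fin (m + 1) → ℝ) +
        (1 - v) * freeMean t y) (by
          filter_upwards [ae_lt_cubeAbove m v] with y hy using
            freeMean_succ_insertNth t b hv0 hv hy),
      integral_add (hintA.const_mul v) ((integrable_freeMean t _).const_mul (1 - v)),
      integral_const_mul, integral_const_mul]
    have h1 := mul_le_mul_of_nonneg_left hA hv0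
    have h2 := mul_le_mul_of_nonneg_left hB (sub_nonneg.2 hv)
    refine le_trans (le_of_eq ?_) (add_le_add h1 h2)
    rw [pow_succ]
    field_simp
    ring

lemma le_integral_freeMean (t n : ℕ) :
    (n : ℝ) * (1 - 1 / (n + 1)) ^ t ≤ ∫ y, freeMean t y ∂cubeAbove n 0 := by
  have h := le_integral_freeMean_of_min_known t
    (fun m v h0 h1 b => le_integral_freeMean_insertNth t m h0 h1 b) n le_rfl zero_le_one
  simpa using h

/-! ### The run of Ranking on the hard instance -/

namespace OnlineInstance

variable (I : OnlineInstance)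

lemma rankingStep_eq_or (y : I.Server → ℝ) (M : Finset (I.Server × I.Request)) (r : I.Request) :
    I.rankingStep y M r = M ∨
      ∃ b ∈ I.best y M r, I.rankingStep y M r = insert (b, r) M := by
  unfold rankingStep
  split_ifs with h
  · refine Or.inr ⟨_, Finset.min'_mem _ h, ?_⟩
    congr!
  · exact Or.inl rfl

lemma mem_available {M : Finset (I.Server × I.Request)} {r : I.Request} {s : I.Server} :
    s ∈ I.available M r ↔ I.Edge s r ∧ ∀ r', (s, r') ∉ M := by
  simp [available]

lemma mem_best {y : I.Server → ℝ} {M : Finset (I.Server × I.Request)} {r : I.Request}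
    {s : I.Server} :
    s ∈ I.best y M r ↔ s ∈ I.available M r ∧ ∀ t ∈ I.available M r, y s ≤ y t := by
  simp [best]

lemma injOn_fst_rankingStep {y : I.Server → ℝ} {M : Finset (I.Server × I.Request)}
    (hM : Set.InjOn Prod.fst (M : Set (I.Server × I.Request))) (r : I.Request) :
    Set.InjOn Prod.fst (I.rankingStep y M r : Set (I.Server × I.Request)) := by
  rcases I.rankingStep_eq_or y M r with h | ⟨b, hb, h⟩ <;> rw [h]
  · exact hM
  · have hfree := (I.mem_available.1 (I.mem_best.1 hb).1).2
    rw [Finset.coe_insert, Set.injOn_insert (hfree r)]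
    refine ⟨hM, ?_⟩
    rintro ⟨p, hp, hpb⟩
    have hpb' : p.1 = b := hpb
    exact hfree p.2 (hpb' ▸ hp)

end OnlineInstance

/-- The private server number `i` of the hard instance, an element of `S₁`. -/
def privateServer {d : ℕ} (i : Fin d) : (hardInstance d).Server :=
  (⟨i, by omega⟩ : Fin (2 * d - 1))

/-- The shared server number `j` of the hard instance, an element of `S₂`. -/
def sharedServer {d : ℕ} (j : Fin (d - 1)) : (hardInstance d).Server :=
  (⟨d + j, by omega⟩ : Fin (2 * d - 1))

/-- The early request number `i` of the hard instance, an element of `R₁`. -/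
def earlyRequest {d : ℕ} (i : Fin d) : (hardInstance d).Request :=
  (⟨i, by omega⟩ : Fin (2 * d - 1))

/-- The late request number `j` of the hard instance, an element of `R₂`. -/
def lateRequest {d : ℕ} (j : Fin (d - 1)) : (hardInstance d).Request :=
  (⟨d + j, by omega⟩ : Fin (2 * d - 1))

lemma sharedServer_injective {d : ℕ} : Function.Injective (sharedServer (d := d)) :=
  fun _ _ h => Fin.ext (Nat.add_left_cancel (Fin.mk.inj_iff.1 h))

lemma finRange_eq_earlyRequest_append_lateRequest (d : ℕ) :
    List.finRange (hardInstance d).numRequests =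
      (List.finRange d).map earlyRequest ++ (List.finRange (d - 1)).map lateRequest := by
  have hnum : (hardInstance d).numRequests = 2 * d - 1 := rfl
  refine List.ext_getElem (by simp [hnum]; omega) fun i h1 h2 => ?_
  rw [List.getElem_append]
  split_ifs with h
  · simp only [List.getElem_finRange, List.getElem_map]
    rfl
  · simp only [List.length_map, List.length_finRange, not_lt] at h
    simp only [List.getElem_finRange, List.getElem_map, List.length_map, List.length_finRange]
    refine Fin.ext ?_
    change i = d + (i - d)
    omega

lemma card_le_countLE {d : ℕ} (y : (hardInstance d).Server → ℝ) (x : ℝ)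
    (T : Finset (hardInstance d).Server)
    (hT : ∀ s ∈ T, d ≤ (s : ℕ) ∧ y s ≤ x) :
    T.card ≤ countLE (fun j => y (sharedServer j)) x := by
  have h : countLE (fun j => y (sharedServer j)) x =
      (Finset.univ.filter fun j : Fin (d - 1) => y (sharedServer j) ≤ x).card := by
    simp [countLE]
  rw [h, ← Finset.card_image_of_injective _ sharedServer_injective]
  refine Finset.card_le_card fun s hs => ?_
  obtain ⟨h1, h2⟩ := hT s hs
  have hs2 : (s : ℕ) < 2 * d - 1 := s.2
  have hs' : sharedServer (⟨s - d, by omega⟩ : Fin (d - 1)) = s := by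
    refine Fin.ext ?_
    change d + ((s : ℕ) - d) = s
    omega
  refine Finset.mem_image.2 ⟨_, ?_, hs'⟩
  simpa [hs'] using h2

/-- What holds for the matching `M` of the hard instance after the early requests in `l` have been
processed, if `advance` has value `k` by then: at most `k` shared servers are matched, and no free
shared server has a smaller rank than a matched one. -/
structure EarlyInvariant {d : ℕ} (y : (hardInstance d).Server → ℝ) (l : List (Fin d))
    (M : Finset ((hardInstance d).Server × (hardInstance d).Request)) (k : ℕ) : Prop where
  injOn : Set.InjOn Prod.fst (M : Set ((hardInstance d).Server × (hardInstance d).Request))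
  card_le : (M.filter fun p => d ≤ (p.1 : ℕ)).card ≤ k
  best_first : ∀ p ∈ M, d ≤ (p.1 : ℕ) → ∀ t : (hardInstance d).Server, d ≤ (t : ℕ) →
    (∀ r, (t, r) ∉ M) → y p.1 ≤ y t
  edge : ∀ p ∈ M, (hardInstance d).Edge p.1 p.2
  mem : ∀ p ∈ M, ∃ i ∈ l, p.2 = earlyRequest i

/-- One more early request. Its private server is still free, so that a shared server is taken only
if its rank is at most the private rank; by `best_first` the same then holds for all shared servers
taken before, and `advance` moves as well unless it is ahead. -/
lemma EarlyInvariant.step {d : ℕ} {y : (hardInstance d).Server → ℝ} {l : List (Fin d)}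
    {M : Finset ((hardInstance d).Server × (hardInstance d).Request)} {k : ℕ}
    (h : EarlyInvariant y l M k) {i : Fin d} (hi : i ∉ l) :
    EarlyInvariant y (l ++ [i]) ((hardInstance d).rankingStep y M (earlyRequest i))
      (advance (fun j => y (sharedServer j)) k (y (privateServer i))) := by
  have hk : k ≤ advance (fun j => y (sharedServer j)) k (y (privateServer i)) := by
    unfold advance
    split_ifs <;> omega
  have hinj := (hardInstance d).injOn_fst_rankingStep (y := y) h.injOn (earlyRequest i)
  rcases (hardInstance d).rankingStep_eq_or y M (earlyRequest i) with hM | ⟨b, hb, hM⟩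
  · rw [hM]
    refine ⟨h.injOn, h.card_le.trans hk, h.best_first, h.edge, fun p hp => ?_⟩
    obtain ⟨j, hj, hpj⟩ := h.mem p hp
    exact ⟨j, by simp [hj], hpj⟩
  obtain ⟨hav, hmin⟩ := (hardInstance d).mem_best.1 hb
  obtain ⟨hbedge, hbfree⟩ := (hardInstance d).mem_available.1 hav
  -- every free shared server is a free neighbor of the request
  have hmin_shared : ∀ t : (hardInstance d).Server, d ≤ (t : ℕ) → (∀ r, (t, r) ∉ M) →
      y b ≤ y t := fun t ht hfree =>
    hmin t ((hardInstance d).mem_available.2 ⟨Or.inr (Or.inl ⟨ht, i.2⟩), hfree⟩)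
  have hpriv : privateServer i ∈
      (hardInstance d).available M (earlyRequest i) := by
    refine (hardInstance d).mem_available.2 ⟨Or.inl ⟨i.2, i.2, rfl⟩, fun r hr => ?_⟩
    obtain ⟨j, hj, hrj⟩ := h.mem _ hr
    have hrj' : r = earlyRequest j := hrj
    subst hrj'
    have hij : i = j := by
      have hj2 := j.2
      have hi2 := i.2
      rcases h.edge _ hr with ⟨-, -, h3⟩ | ⟨h3, -⟩ | ⟨-, h3⟩
      · exact Fin.ext h3
      · exact absurd hi2 (not_lt.2 h3)
      · exact absurd hj2 (not_lt.2 h3)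
    exact hi (hij ▸ hj)
  have hcard : ((insert (b, earlyRequest i) M).filter fun p => d ≤ (p.1 : ℕ)).card ≤
      advance (fun j => y (sharedServer j)) k (y (privateServer i)) := by
    by_cases hbd : d ≤ (b : ℕ)
    · have hcount : ((insert (b, earlyRequest i) M).filter fun p => d ≤ (p.1 : ℕ)).card ≤
          countLE (fun j => y (sharedServer j)) (y (privateServer i)) := by
        rw [hM] at hinj
        rw [← Finset.card_image_of_injOn (f := Prod.fst)
          (hinj.mono (Finset.coe_subset.2 (Finset.filter_subset _ _)))]
        refine card_le_countLE y _ _ fun s hs => ?_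
        obtain ⟨p, hp, rfl⟩ := Finset.mem_image.1 hs
        obtain ⟨hpM, hpd⟩ := Finset.mem_filter.1 hp
        refine ⟨hpd, ?_⟩
        rcases Finset.mem_insert.1 hpM with rfl | hpM
        · exact hmin _ hpriv
        · exact (h.best_first p hpM hpd b hbd hbfree).trans (hmin _ hpriv)
      have hold := h.card_le
      rw [Finset.filter_insert, if_pos hbd, Finset.card_insert_of_notMem
        (fun hmem => hbfree _ (Finset.mem_filter.1 hmem).1)] at hcount ⊢
      unfold advance
      split_ifs <;> omega
    · rw [Finset.filter_insert, if_neg hbd]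
      exact h.card_le.trans hk
  rw [hM] at hinj ⊢
  refine ⟨hinj, hcard, ?_, ?_, ?_⟩
  · intro p hp hpd t htd hfree
    have hfree' : ∀ r, (t, r) ∉ M := fun r hr => hfree r (Finset.mem_insert_of_mem hr)
    rcases Finset.mem_insert.1 hp with rfl | hp
    · exact hmin_shared t htd hfree'
    · exact h.best_first p hp hpd t htd hfree'
  · intro p hp
    rcases Finset.mem_insert.1 hp with rfl | hp
    · exact hbedge
    · exact h.edge p hp
  · intro p hp
    rcases Finset.mem_insert.1 hp with rfl | hp
    · exact ⟨i, by simp, rfl⟩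
    · obtain ⟨j, hj, hpj⟩ := h.mem p hp
      exact ⟨j, by simp [hj], hpj⟩

lemma earlyInvariant_foldl {d : ℕ} (y : (hardInstance d).Server → ℝ) (l : List (Fin d))
    (hl : l.Nodup) :
    EarlyInvariant y l ((l.map earlyRequest).foldl ((hardInstance d).rankingStep y) ∅)
      ((l.map fun i => y (privateServer i)).foldl (advance fun j => y (sharedServer j)) 0) := by
  induction l using List.reverseRecOn with
  | nil => constructor <;> simp [List.foldl_nil]
  | append_singleton l i ih =>
    rw [List.nodup_append] at hl
    have hi : i ∉ l := fun h => hl.2.2 i h i (by simp) rfl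
    rw [List.map_append, List.map_append, List.foldl_append, List.foldl_append]
    exact (ih hl.1).step hi

/-- Late requests are not adjacent to shared servers. -/
lemma late_foldl {d : ℕ} (y : (hardInstance d).Server → ℝ) (l : List (Fin (d - 1)))
    {M : Finset ((hardInstance d).Server × (hardInstance d).Request)} {k : ℕ}
    (hinj : Set.InjOn Prod.fst (M : Set ((hardInstance d).Server × (hardInstance d).Request)))
    (hcard : (M.filter fun p => d ≤ (p.1 : ℕ)).card ≤ k) :
    Set.InjOn Prod.fst (((l.map lateRequest).foldl ((hardInstance d).rankingStep y) M :
      Finset ((hardInstance d).Server × (hardInstance d).Request)) :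
      Set ((hardInstance d).Server × (hardInstance d).Request)) ∧
    (((l.map lateRequest).foldl ((hardInstance d).rankingStep y) M).filter
      fun p => d ≤ (p.1 : ℕ)).card ≤ k := by
  induction l generalizing M with
  | nil => exact ⟨hinj, hcard⟩
  | cons j l ih =>
    refine ih ((hardInstance d).injOn_fst_rankingStep hinj _) ?_
    rcases (hardInstance d).rankingStep_eq_or y M (lateRequest j) with hM | ⟨b, hb, hM⟩ <;> rw [hM]
    · exact hcard
    · have hedge := ((hardInstance d).mem_available.1 ((hardInstance d).mem_best.1 hb).1).1
      have hbd : ¬ d ≤ (b : ℕ) := by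
        have hj : d ≤ (lateRequest j : ℕ) := Nat.le_add_right _ _
        rcases hedge with ⟨h1, -⟩ | ⟨-, h1⟩ | ⟨h1, -⟩
        · exact not_le.2 h1
        · exact absurd h1 (not_lt.2 hj)
        · exact not_le.2 h1
      rwa [Finset.filter_insert, if_neg hbd]

/-- The size of the matching is at most the number of private servers, all of which may be matched,
plus the number of shared servers that `advance` counts during the early requests. -/
lemma card_rankingMatching_le {d : ℕ} (y : (hardInstance d).Server → ℝ) :
    ((hardInstance d).rankingMatching y).card ≤ d +
      (List.ofFn fun i : Fin d => y (privateServer i)).foldl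
        (advance fun j => y (sharedServer j)) 0 := by
  have h1 := earlyInvariant_foldl y (List.finRange d) (List.nodup_finRange d)
  have h2 := late_foldl y (List.finRange (d - 1)) h1.injOn h1.card_le
  rw [← List.foldl_append, ← finRange_eq_earlyRequest_append_lateRequest, ← List.ofFn_eq_map] at h2
  change Set.InjOn Prod.fst ((hardInstance d).rankingMatching y :
    Set ((hardInstance d).Server × (hardInstance d).Request)) ∧
    (((hardInstance d).rankingMatching y).filter fun p => d ≤ (p.1 : ℕ)).card ≤ _ at h2
  obtain ⟨hinj, hcard⟩ := h2
  have hpriv : (((hardInstance d).rankingMatching y).filter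
      fun p => ¬ d ≤ (p.1 : ℕ)).card ≤ d := by
    rw [← Finset.card_image_of_injOn (f := fun p => (p.1 : ℕ)) (fun p hp q hq hpq =>
      hinj (Finset.mem_filter.1 hp).1 (Finset.mem_filter.1 hq).1 (Fin.ext hpq))]
    refine (Finset.card_le_card (t := Finset.range d) fun s hs => ?_).trans (by simp)
    obtain ⟨p, hp, rfl⟩ := Finset.mem_image.1 hs
    exact Finset.mem_range.2 (not_le.1 (Finset.mem_filter.1 hp).2)
  rw [← Finset.card_filter_add_card_filter_not (p := fun p => d ≤ (p.1 : ℕ)), add_comm]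
  exact add_le_add hpriv hcard

/-! ### The expectation -/

/-- The servers of the hard instance are the private and the shared ones. -/
def serverEquiv {d : ℕ} (hd : 0 < d) : Fin d ⊕ Fin (d - 1) ≃ (hardInstance d).Server :=
  finSumFinEquiv.trans (finCongr (by omega : d + (d - 1) = 2 * d - 1))

/-- The ranks of the private and of the shared servers, listed together. -/
noncomputable def joinRanks {d : ℕ} (hd : 0 < d) :
    (Fin d → ℝ) × (Fin (d - 1) → ℝ) ≃ᵐ ((hardInstance d).Server → ℝ) :=
  (MeasurableEquiv.sumPiEquivProdPi fun _ : Fin d ⊕ Fin (d - 1) => ℝ).symm.trans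
    (MeasurableEquiv.piCongrLeft (fun _ => ℝ) (serverEquiv hd))

lemma joinRanks_privateServer {d : ℕ} (hd : 0 < d) (z : (Fin d → ℝ) × (Fin (d - 1) → ℝ))
    (i : Fin d) :
    joinRanks hd z (privateServer i) = z.1 i := by
  exact Equiv.piCongrLeft_apply_apply (fun _ : (hardInstance d).Server => ℝ)
    (serverEquiv hd) _ (Sum.inl i)

lemma joinRanks_sharedServer {d : ℕ} (hd : 0 < d) (z : (Fin d → ℝ) × (Fin (d - 1) → ℝ))
    (j : Fin (d - 1)) : joinRanks hd z (sharedServer j) = z.2 j := by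
  exact Equiv.piCongrLeft_apply_apply (fun _ : (hardInstance d).Server => ℝ)
    (serverEquiv hd) _ (Sum.inr j)

lemma measurePreserving_joinRanks {d : ℕ} (hd : 0 < d) :
    MeasurePreserving (joinRanks hd) ((cubeAbove d 0).prod (cubeAbove (d - 1) 0))
      (hardInstance d).rankLaw := by
  have hlaw : (hardInstance d).rankLaw =
      Measure.pi fun _ : (hardInstance d).Server => volume.restrict (Set.Ioc (0 : ℝ) 1) := by
    unfold OnlineInstance.rankLaw
    congr 1
    funext _
    exact (Measure.restrict_congr_set Ioc_ae_eq_Icc).symm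
  rw [hlaw]
  exact (measurePreserving_sumPiEquivProdPi fun _ : Fin d ⊕ Fin (d - 1) =>
    (volume : Measure ℝ).restrict (Set.Ioc 0 1)).symm.trans
    (measurePreserving_piCongrLeft (fun _ : (hardInstance d).Server =>
      (volume : Measure ℝ).restrict (Set.Ioc 0 1)) _)

lemma expectedRanking_hardInstance_le {d : ℕ} (hd : 0 < d) :
    (hardInstance d).expectedRanking ≤
      (2 * d - 1) - ((d : ℝ) - 1) * (1 - 1 / d) ^ d := by
  have hmp := measurePreserving_joinRanks hd
  have hint : Integrable
      (fun z => (((hardInstance d).rankingMatching (joinRanks hd z)).card : ℝ))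
      ((cubeAbove d 0).prod (cubeAbove (d - 1) 0)) :=
    hmp.integrable_comp_of_integrable (hardInstance d).integrable_card_rankingMatching
  have hcomp := hmp.integral_comp' fun y => (((hardInstance d).rankingMatching y).card : ℝ)
  have hmass : ∀ n, (cubeAbove n 0).real Set.univ = 1 := fun n => by
    simp [cubeAbove_real_univ n zero_le_one]
  have hinner : ∀ w : Fin (d - 1) → ℝ,
      ∫ x, (((hardInstance d).rankingMatching (joinRanks hd (x, w))).card : ℝ) ∂cubeAbove d 0 ≤
        d + chainMean (advanceProb w) d 0 := by
    intro w
    have h : ∫ x, ((d : ℝ) + (((List.ofFn x).foldl (advance w) 0 : ℕ) : ℝ)) ∂cubeAbove d 0 =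
        d + chainMean (advanceProb w) d 0 := by
      rw [integral_add (integrable_const _) (integrable_foldl_advance w d 0 _),
        integral_foldl_advance]
      simp [hmass]
    rw [← h]
    refine integral_mono_of_nonneg (Filter.Eventually.of_forall fun x => Nat.cast_nonneg _)
      ((integrable_const _).add (integrable_foldl_advance w d 0 _))
      (Filter.Eventually.of_forall fun x => ?_)
    have hle := card_rankingMatching_le (joinRanks hd (x, w))
    simp only [joinRanks_privateServer, joinRanks_sharedServer] at hle
    change (((hardInstance d).rankingMatching (joinRanks hd (x, w))).card : ℝ) ≤
      (d : ℝ) + (((List.ofFn x).foldl (advance w) 0 : ℕ) : ℝ)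
    exact_mod_cast hle
  have hfree := le_integral_freeMean d (d - 1)
  unfold freeMean at hfree
  rw [integral_sub (integrable_const _) (integrable_chainMean_advanceProb d _)] at hfree
  simp only [integral_const, hmass, smul_eq_mul, one_mul] at hfree
  have hcast : ((d - 1 : ℕ) : ℝ) = d - 1 := by
    rw [Nat.cast_sub hd, Nat.cast_one]
  rw [hcast, sub_add_cancel] at hfree
  unfold OnlineInstance.expectedRanking
  calc ∫ y, (((hardInstance d).rankingMatching y).card : ℝ) ∂(hardInstance d).rankLaw
      = ∫ w, ∫ x, (((hardInstance d).rankingMatching (joinRanks hd (x, w))).card : ℝ)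
          ∂cubeAbove d 0 ∂cubeAbove (d - 1) 0 := by
        rw [← hcomp]
        exact integral_prod_symm _ hint
    _ ≤ ∫ w, ((d : ℝ) + chainMean (advanceProb w) d 0) ∂cubeAbove (d - 1) 0 :=
        integral_mono hint.integral_prod_right
          ((integrable_const _).add (integrable_chainMean_advanceProb d _)) hinner
    _ = d + ∫ w, chainMean (advanceProb w) d 0 ∂cubeAbove (d - 1) 0 := by
        rw [integral_add (integrable_const _) (integrable_chainMean_advanceProb d _)]
        simp [hmass]
    _ ≤ _ := by linarith

/-! ### Degrees and maximum matchings of the hard instance -/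

namespace OnlineInstance

variable (I : OnlineInstance)

lemma graph_adj_inl_inr {s : I.Server} {r : I.Request} :
    I.graph.Adj (Sum.inl s) (Sum.inr r) ↔ I.Edge s r := Iff.rfl

lemma graph_adj_inr_inl {s : I.Server} {r : I.Request} :
    I.graph.Adj (Sum.inr r) (Sum.inl s) ↔ I.Edge s r := Iff.rfl

lemma not_graph_adj_inl_inl {s t : I.Server} : ¬ I.graph.Adj (Sum.inl s) (Sum.inl t) := id

lemma not_graph_adj_inr_inr {r q : I.Request} : ¬ I.graph.Adj (Sum.inr r) (Sum.inr q) := id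

end OnlineInstance

/-- The edge relation of the hard instance, read on indices, is symmetric. Hence a count of the
neighbors of a server is also one of the neighbors of a request. -/
lemma hardInstance_edge_symm {d : ℕ} {a b : Fin (2 * d - 1)} (h : (hardInstance d).Edge a b) :
    (hardInstance d).Edge b a := by
  rcases h with ⟨h1, h2, h3⟩ | ⟨h1, h2⟩ | ⟨h1, h2⟩
  · exact Or.inl ⟨h2, h1, h3.symm⟩
  · exact Or.inr (Or.inr ⟨h2, h1⟩)
  · exact Or.inr (Or.inl ⟨h2, h1⟩)

lemma hardInstance_edge_iff {d : ℕ} (a b : Fin (2 * d - 1)) :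
    (hardInstance d).Edge a b ↔
      ((a : ℕ) < d ∧ (b : ℕ) < d ∧ (a : ℕ) = b) ∨ (d ≤ (a : ℕ) ∧ (b : ℕ) < d) ∨
        ((a : ℕ) < d ∧ d ≤ (b : ℕ)) :=
  Iff.rfl

open scoped Classical in
lemma card_filter_hardInstance_edge {d : ℕ} (s : Fin (2 * d - 1)) :
    (Finset.univ.filter fun r : Fin (2 * d - 1) => (hardInstance d).Edge s r).card = d := by
  by_cases hs : (s : ℕ) < d
  · let late : Fin (d - 1) → Fin (2 * d - 1) := fun j => ⟨d + j, by omega⟩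
    have hlate : Function.Injective late :=
      fun _ _ h => Fin.ext (Nat.add_left_cancel (Fin.mk.inj_iff.1 h))
    have h : (Finset.univ.filter fun r : Fin (2 * d - 1) => (hardInstance d).Edge s r) =
        insert s (Finset.univ.image late) := by
      ext r
      rw [Finset.mem_filter, hardInstance_edge_iff]
      simp only [Finset.mem_univ, true_and, Finset.mem_insert,
        Finset.mem_image, Fin.ext_iff, late]
      constructor
      · rintro (h | h | h)
        · exact Or.inl h.2.2.symm
        · omega
        · exact Or.inr ⟨⟨r - d, by omega⟩, by simp [h.2]⟩
      · rintro (h | ⟨j, hj⟩) <;> omega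
    have hnot : s ∉ Finset.univ.image late := by
      simp only [Finset.mem_image, Finset.mem_univ, true_and, Fin.ext_iff, late, not_exists]
      omega
    rw [h, Finset.card_insert_of_notMem hnot, Finset.card_image_of_injective _ hlate]
    simp
    omega
  · let early : Fin d → Fin (2 * d - 1) := fun i => ⟨i, by omega⟩
    have hearly : Function.Injective early := fun _ _ h => Fin.ext (Fin.mk.inj_iff.1 h)
    have h : (Finset.univ.filter fun r : Fin (2 * d - 1) => (hardInstance d).Edge s r) =
        Finset.univ.image early := by
      ext r
      rw [Finset.mem_filter, hardInstance_edge_iff]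
      simp only [Finset.mem_univ, true_and,
        Finset.mem_image, Fin.ext_iff, early]
      constructor
      · rintro (h | h | h)
        · omega
        · exact ⟨⟨r, h.2⟩, rfl⟩
        · omega
      · rintro ⟨j, hj⟩
        omega
    rw [h, Finset.card_image_of_injective _ hearly]
    simp

lemma isRegular_hardInstance (d : ℕ) : (hardInstance d).IsRegular d := by
  classical
  intro v
  rw [← SimpleGraph.card_neighborFinset_eq_degree]
  rcases v with s | r
  · have h : (hardInstance d).graph.neighborFinset (Sum.inl s) =
        (Finset.univ.filter fun r : (hardInstance d).Request => (hardInstance d).Edge s r).image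
          Sum.inr := by
      ext (t | t)
      · simp [OnlineInstance.not_graph_adj_inl_inl]
      · simp [OnlineInstance.graph_adj_inl_inr]
    rw [h, Finset.card_image_of_injective _ Sum.inr_injective]
    exact card_filter_hardInstance_edge s
  · have h : (hardInstance d).graph.neighborFinset (Sum.inr r) =
        (Finset.univ.filter fun s : (hardInstance d).Server => (hardInstance d).Edge s r).image
          Sum.inl := by
      ext (t | t)
      · simp [OnlineInstance.graph_adj_inr_inl]
      · simp [OnlineInstance.not_graph_adj_inr_inr]
    rw [h, Finset.card_image_of_injective _ Sum.inl_injective]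
    rw [Finset.filter_congr (q := fun s : (hardInstance d).Server =>
      (hardInstance d).Edge (show Fin (2 * d - 1) from r) s)
      fun s _ => ⟨hardInstance_edge_symm, hardInstance_edge_symm⟩]
    exact card_filter_hardInstance_edge r

namespace OnlineInstance

variable (I : OnlineInstance)

lemma ncard_edgeSet_le_of_isMatching {M : I.graph.Subgraph} (hM : M.IsMatching) :
    M.edgeSet.ncard ≤ I.numServers := by
  classical
  let f : I.Server → Sym2 (I.Server ⊕ I.Request) := fun s =>
    if h : ∃ w, M.Adj (Sum.inl s) w then s(Sum.inl s, h.choose) else s(Sum.inl s, Sum.inl s)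
  have hf : ∀ s w, M.Adj (Sum.inl s) w → f s = s(Sum.inl s, w) := by
    intro s w hw
    have h : ∃ w, M.Adj (Sum.inl s) w := ⟨w, hw⟩
    simp only [f, dif_pos h]
    rw [hM.eq_of_adj_left h.choose_spec hw]
  have hsub : M.edgeSet ⊆ Set.range f := by
    intro e
    induction e with
    | _ a b =>
      intro hab
      have hadj : M.Adj a b := hab
      have hG : I.graph.Adj a b := hadj.adj_sub
      rcases a with a | a <;> rcases b with b | b
      · exact hG.elim
      · exact ⟨a, hf a _ hadj⟩
      · exact ⟨b, (hf b _ hadj.symm).trans Sym2.eq_swap⟩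
      · exact hG.elim
  calc M.edgeSet.ncard ≤ (Set.range f).ncard := Set.ncard_le_ncard hsub (Set.finite_range f)
    _ ≤ (Set.univ : Set I.Server).ncard := by
        rw [← Set.image_univ]
        exact Set.ncard_image_le Set.finite_univ
    _ = I.numServers := by simp [Set.ncard_univ]

/-- The subgraph whose edges join each server `s` with the request `σ s`. -/
def matchingOfEquiv (σ : I.Server ≃ I.Request) (hσ : ∀ s, I.Edge s (σ s)) :
    I.graph.Subgraph where
  verts := Set.univ
  Adj
    | Sum.inl s, Sum.inr r => σ s = r
    | Sum.inr r, Sum.inl s => σ s = r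
    | Sum.inl _, Sum.inl _ => False
    | Sum.inr _, Sum.inr _ => False
  adj_sub := by
    rintro (a | a) (b | b) h
    · exact h.elim
    · subst h
      exact hσ a
    · subst h
      exact hσ b
    · exact h.elim
  edge_vert := fun _ => trivial
  symm := ⟨by rintro (a | a) (b | b) h <;> exact h⟩

lemma isMatching_matchingOfEquiv (σ : I.Server ≃ I.Request) (hσ : ∀ s, I.Edge s (σ s)) :
    (I.matchingOfEquiv σ hσ).IsMatching := by
  rintro (s | r) -
  · refine ⟨Sum.inr (σ s), rfl, ?_⟩
    rintro (t | t) h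
    · exact h.elim
    · exact congrArg Sum.inr (Eq.symm h)
  · refine ⟨Sum.inl (σ.symm r), σ.apply_symm_apply r, ?_⟩
    rintro (t | t) h
    · exact congrArg Sum.inl (σ.eq_symm_apply.2 h)
    · exact h.elim

lemma ncard_edgeSet_matchingOfEquiv (σ : I.Server ≃ I.Request) (hσ : ∀ s, I.Edge s (σ s)) :
    (I.matchingOfEquiv σ hσ).edgeSet.ncard = I.numServers := by
  refine le_antisymm
    (I.ncard_edgeSet_le_of_isMatching (I.isMatching_matchingOfEquiv σ hσ)) ?_
  let f : I.Server → Sym2 (I.Server ⊕ I.Request) := fun s => s(Sum.inl s, Sum.inr (σ s))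
  have hf : Function.Injective f := by
    intro s t hst
    simpa [f] using hst
  have hsub : Set.range f ⊆ (I.matchingOfEquiv σ hσ).edgeSet := by
    rintro _ ⟨s, rfl⟩
    exact (rfl : σ s = σ s)
  calc I.numServers = (Set.range f).ncard := by
        rw [← Set.image_univ, Set.ncard_image_of_injective _ hf]
        simp [Set.ncard_univ]
    _ ≤ _ := Set.ncard_le_ncard hsub (Set.toFinite _)

lemma opt_eq_numServers (σ : I.Server ≃ I.Request) (hσ : ∀ s, I.Edge s (σ s)) :
    I.opt = I.numServers := by
  refine IsGreatest.csSup_eq ⟨⟨I.matchingOfEquiv σ hσ, I.isMatching_matchingOfEquiv σ hσ,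
    I.ncard_edgeSet_matchingOfEquiv σ hσ⟩, ?_⟩
  rintro k ⟨M, hM, rfl⟩
  exact I.ncard_edgeSet_le_of_isMatching hM

lemma expectedRanking_nonneg : 0 ≤ I.expectedRanking :=
  integral_nonneg fun _ => Nat.cast_nonneg _

end OnlineInstance

lemma opt_hardInstance (d : ℕ) : (hardInstance d).opt = 2 * d - 1 := by
  -- the last private server is matched to its own request, all other pairs are at distance `d`
  let τ : Fin (2 * d - 1) → Fin (2 * d - 1) := fun s =>
    if h : (s : ℕ) < d - 1 then ⟨s + d, by omega⟩
    else if (s : ℕ) = d - 1 then s else ⟨s - d, by omega⟩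
  have hval : ∀ s, (τ s : ℕ) =
      if (s : ℕ) < d - 1 then (s : ℕ) + d else if (s : ℕ) = d - 1 then (s : ℕ) else s - d := by
    intro s
    simp only [τ]
    split_ifs <;> rfl
  have hτ : Function.Involutive τ := by
    intro s
    refine Fin.ext ?_
    rw [hval, hval]
    split_ifs <;> omega
  have hedge : ∀ s : Fin (2 * d - 1), (hardInstance d).Edge s (τ s) := by
    intro s
    rw [hardInstance_edge_iff, hval]
    split_ifs <;> omega
  exact (hardInstance d).opt_eq_numServers (hτ.toPerm τ) hedge

theorem mainTheorem1 (d : ℕ) (hd : 2 ≤ d) :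
    rankingCompetitiveRatio d ≤ rankingBound d ∧
      (hardInstance d).IsRegular d ∧
      (hardInstance d).numServers = 2 * d - 1 ∧
      (hardInstance d).opt = 2 * d - 1 ∧
      (hardInstance d).expectedRanking / ((hardInstance d).opt : ℝ) ≤ rankingBound d := by
  have hopt := opt_hardInstance d
  have hcast : ((hardInstance d).opt : ℝ) = 2 * d - 1 := by
    rw [hopt, Nat.cast_sub (by omega)]
    push_cast
    ring
  have hd' : (2 : ℝ) ≤ d := by exact_mod_cast hd
  have hratio : (hardInstance d).expectedRanking / ((hardInstance d).opt : ℝ) ≤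
      rankingBound d := by
    have hpos : (0 : ℝ) < 2 * d - 1 := by linarith
    rw [hcast, div_le_iff₀ hpos]
    refine (expectedRanking_hardInstance_le (by omega)).trans (le_of_eq ?_)
    unfold rankingBound
    field_simp
  refine ⟨(csInf_le ⟨0, ?_⟩ ?_).trans hratio, isRegular_hardInstance d, rfl, hopt, hratio⟩
  · rintro _ ⟨I, -, -, rfl⟩
    exact div_nonneg I.expectedRanking_nonneg (Nat.cast_nonneg _)
  · exact ⟨hardInstance d, isRegular_hardInstance d, by omega, rfl⟩
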